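/- **Setting.** Let $H_A,H_B,H_E$ be complex Hilbert spaces of arbitrary (possibly infinite) dimension, let $N\ge 1$, and let the $N$ systems of Alice and of Bob be divided into $l\ge1$ blocks. For the systems of block $i$ Alice has a discrete POVM $\{M^{Ai}_x\}_x$ on $H_A$, a region $\Xi(X^i)$ of observed results, and $D^{Ai}=\sum_{x\in\Xi(X^i)}M^{Ai}_x$; let $\tilde D^A$ be a POVM element ($0\le\tilde D^A\le 1$) with $\tilde D^A\ge D^{Ai}$ for all $i$. The accepted results of block $i$ are the elements of $\Xi(X^i)$ and one further symbol with POVM element $\tilde D^A-D^{Ai}$. The same is given for Bob. Let $P_A,P_B$ be the projections onto finite-dimensional subspaces of $H_A,H_B$ (the filters). An attack is a unit vector $\Psi\in H_A^{\otimes N}\otimes H_B^{\otimes N}\otimes H_E$, and $\mathcal S$ is any set of attacks (for instance, all of them); write $\rho_{A^NB^NE^N}=|\Psi\rangle\langle\Psi|$ and $p(\Psi)=\mathrm{tr}[(\tilde D^A\otimes\tilde D^B)^{\otimes N}\rho_{A^NB^NE^N}]$. In protocol 1 all systems of $\Psi$ are measured; $\rho_{X^NY^NE^N}=\rho_{X^NY^NE^N}(\Psi)$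 is the normalized state of the results and of $E$, given that all results are accepted, i.e. proportional to $\sum_{x,y}|x,y\rangle\langle x,y|\otimes \mathrm{tr}_{A^NB^N}\bigl[K_{xy}\rho_{A^NB^NE^N}K_{xy}^\dagger\bigr]$, where $K_{xy}=\bigotimes_k\sqrt{M_{x_k}}\otimes\bigotimes_k\sqrt{M_{y_k}}\otimes 1_E$. In protocol 2 the systems pass the filters first: $\tilde\rho_{X^NY^NE^N}$ is the state obtained in the same way from $((P_A\otimes P_B)^{\otimes N}\otimes 1_E)\Psi$ in place of $\Psi$. (A state that would be conditioned on an event of probability $0$ is read as $0$.) In both protocols the results of the first block are published, and parameter estimation accepts iff they lie in a given set; a given randomized classical processing of the results yields strings $\bar X,\bar Y$ and a public announcement, and $\bar E$ consists of $E$, the published results and the announcement. A given information reconciliation procedure with leakage $\mathrm{leak}_{IR}=\log_2|C|-\inf_{\bar x,\bar y}H_{\min}(C|\bar x,\bar y)$ ($C$ its transcript) is called $\epsilon''$-secure if for all input strings it yields a wrong guess with probability at most $\epsilon''$. $H^{\epsilon'}_{\min}$ is the smooth min-entropy, with smoothing over positive operators $\rho'$ (classical on the same registers) with $\mathrm{tr}\rho'\le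 \mathrm{tr}\rho$ and $\|\rho'-\rho\|_1\le\epsilon'\,\mathrm{tr}\rho$. Given a state $\sigma(\Psi)$ of $X^NY^NE$ and an acceptance probability $a(\Psi)$ for each $\Psi\in\mathcal S$, the *$\epsilon$-secure key rate* is $$\sup\ \frac1N\Bigl(\inf_{\Psi\in\mathcal S,\ a(\Psi)>\epsilon'''}H^{\epsilon'}_{\min}(\sigma(\Psi)_{\bar X\bar E}\,|\,\bar E)-\mathrm{leak}_{IR}\Bigr),$$ the supremum over all $\epsilon',\epsilon'',\epsilon'''\ge0$ with $\epsilon'+\epsilon''+\epsilon'''=\epsilon$ such that the reconciliation is $\epsilon''$-secure. Let $a_1(\Psi)$ be $p(\Psi)$ times the probability that parameter estimation accepts the results of $\rho_{X^NY^NE^N}(\Psi)$, and $a_2(\Psi)$ the probability that it accepts the results of $\tilde\rho_{X^NY^NE^N}(\Psi)$. The rate $R_1$ of protocol 1 is that for $\sigma=\rho_{X^NY^NE^N}$ and $a=a_1$; the rate $R_2$ of protocol 2 with parameter estimation from the data of protocol 1 is that for $\sigma=\tilde\rho_{X^NY^NE^N}$ and $a=a_1$; the rate $R_2^{\mathrm{own}}$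 of protocol 2 with its own data is that for $\sigma=\tilde\rho_{X^NY^NE^N}$ and $a=a_2$. **Theorem 2.** Let $\delta>0$, $\epsilon\ge0$, and suppose that $\|\rho_{X^NY^NE^N}-\tilde\rho_{X^NY^NE^N}\|_1\le2\delta$ for every $\Psi\in\mathcal S$ with $p(\Psi)\ge\delta$. Then the $(5\delta+\epsilon)$-secure key rate of protocol 1 is at least the $(2\delta+\epsilon)$-secure key rate of protocol 2 in which the data of protocol 1 are used for parameter estimation, $R_1(5\delta+\epsilon)\ge R_2(2\delta+\epsilon)$; and the latter is at least the $\epsilon$-secure key rate of protocol 2 with its own data, $R_2(2\delta+\epsilon)\ge R_2^{\mathrm{own}}(\epsilon)$. -/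

import Mathlib

open scoped ENNReal NNReal InnerProductSpace

noncomputable section

namespace QKD

universe u v w a

/-! ### Hilbert spaces, tensor powers, partial trace

Every Hilbert space is `ℓ²(ι)` for the index set `ι` of an orthonormal basis; the index set is
arbitrary, so the dimension is arbitrary, possibly infinite.  The Hilbert tensor product of
`ℓ²(ι)` and `ℓ²(κ)` is `ℓ²(ι × κ)`. -/

/-- The Hilbert space `ℓ²(ι)` over `ℂ`. -/
abbrev L2 (ι : Type*) := lp (fun _ : ι => ℂ) 2

/-- Bounded operators on `ℓ²(ι)`. -/
abbrev Op (ι : Type*) := L2 ι →L[ℂ] L2 ι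

theorem summable_sq {ι : Type*} (f : L2 ι) : Summable fun i => ‖f i‖ ^ (2 : ℝ) := by
  simpa using (lp.memℓp f).summable (by norm_num)

theorem norm_sq_eq {ι : Type*} (f : L2 ι) : ‖f‖ ^ (2 : ℝ) = ∑' i, ‖f i‖ ^ (2 : ℝ) := by
  simpa using lp.norm_rpow_eq_tsum (p := 2) (by norm_num) f

/-- Restriction of `f ∈ ℓ²(ι)` along an injection `κ → ι`. -/
def restrict {ι κ : Type*} (φ : κ → ι) (hφ : Function.Injective φ) : L2 ι →ₗ[ℂ] L2 κ where
  toFun f := ⟨fun j => f (φ j), memℓp_gen (by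
    simpa using! (summable_sq f).comp_injective hφ)⟩
  map_add' _ _ := rfl
  map_smul' _ _ := rfl

/-- For `e : ι ≃ α × ρ` and `r : ρ`, the slice `a ↦ f (a, r)` of `f ∈ ℓ²(ι) = ℓ²(α) ⊗ ℓ²(ρ)`. -/
def slice {ι α ρ : Type*} (e : ι ≃ α × ρ) (r : ρ) : L2 ι →ₗ[ℂ] L2 α :=
  restrict (fun a => e.symm (a, r)) (fun _ _ h => (Prod.ext_iff.1 (e.symm.injective h)).1)

theorem hasSum_slice {ι α ρ : Type*} (e : ι ≃ α × ρ) (f : L2 ι) :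
    HasSum (fun r => ‖slice e r f‖ ^ (2 : ℝ)) (‖f‖ ^ (2 : ℝ)) := by
  have h1 : HasSum (fun i => ‖f i‖ ^ (2 : ℝ)) (‖f‖ ^ (2 : ℝ)) := by
    rw [norm_sq_eq]; exact (summable_sq f).hasSum
  let e' : ρ × α ≃ ι := (Equiv.prodComm ρ α).trans e.symm
  have h2 : HasSum (fun p : ρ × α => ‖f (e' p)‖ ^ (2 : ℝ)) (‖f‖ ^ (2 : ℝ)) :=
    e'.hasSum_iff.2 h1
  refine h2.prod_fiberwise fun r => ?_
  rw [norm_sq_eq]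
  exact (summable_sq (slice e r f)).hasSum

theorem summable_lift {ι α ρ : Type*} (e : ι ≃ α × ρ) (T : Op α) (f : L2 ι) :
    Summable (fun i => ‖T (slice e (e i).2 f) (e i).1‖ ^ (2 : ℝ)) ∧
      ∑' i, ‖T (slice e (e i).2 f) (e i).1‖ ^ (2 : ℝ) ≤ (‖T‖ * ‖f‖) ^ (2 : ℝ) := by
  have hle : ∀ r, ‖T (slice e r f)‖ ^ (2 : ℝ) ≤ ‖T‖ ^ (2 : ℝ) * ‖slice e r f‖ ^ (2 : ℝ) := by
    intro r
    rw [← Real.mul_rpow (norm_nonneg _) (norm_nonneg _)]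
    exact Real.rpow_le_rpow (norm_nonneg _) (T.le_opNorm _) (by norm_num)
  have hs := (hasSum_slice e f).mul_left (‖T‖ ^ (2 : ℝ))
  have hsum : Summable fun r => ‖T (slice e r f)‖ ^ (2 : ℝ) :=
    Summable.of_nonneg_of_le (fun _ => by positivity) hle hs.summable
  let e' : ρ × α ≃ ι := (Equiv.prodComm ρ α).trans e.symm
  have hF : Summable fun p : ρ × α => ‖T (slice e p.1 f) p.2‖ ^ (2 : ℝ) := by
    refine (summable_prod_of_nonneg (fun p => Real.rpow_nonneg (norm_nonneg _) _)).2
      ⟨fun r => summable_sq (T (slice e r f)), ?_⟩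
    exact hsum.congr fun r => norm_sq_eq (T (slice e r f))
  have hcomp : (fun i => ‖T (slice e (e i).2 f) (e i).1‖ ^ (2 : ℝ)) ∘ e'
      = fun p : ρ × α => ‖T (slice e p.1 f) p.2‖ ^ (2 : ℝ) := by
    funext p; simp [e']
  refine ⟨e'.summable_iff.1 (by rw [hcomp]; exact hF), ?_⟩
  rw [← e'.tsum_eq]
  have : ∑' p, ‖T (slice e (e (e' p)).2 f) (e (e' p)).1‖ ^ (2 : ℝ)
      = ∑' p : ρ × α, ‖T (slice e p.1 f) p.2‖ ^ (2 : ℝ) :=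
    tsum_congr fun p => congrFun hcomp p
  rw [this, hF.tsum_prod, Real.mul_rpow (norm_nonneg _) (norm_nonneg _), ← hs.tsum_eq]
  simp only [← norm_sq_eq]
  exact hsum.tsum_le_tsum hle hs.summable

/-- `T ⊗ 1` on `ℓ²(ι) = ℓ²(α) ⊗ ℓ²(ρ)`, where `e : ι ≃ α × ρ`: the operator `T` acts on every
slice `a ↦ f (a, r)`. -/
def liftOp {ι α ρ : Type*} (e : ι ≃ α × ρ) (T : Op α) : Op ι :=
  LinearMap.mkContinuous
    { toFun := fun f => ⟨fun i => T (slice e (e i).2 f) (e i).1, memℓp_gen (by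
        simpa using (summable_lift e T f).1)⟩
      map_add' := fun f g => by ext i; simp only [map_add]; rfl
      map_smul' := fun c f => by ext i; simp only [map_smul]; rfl }
    ‖T‖ (fun f => by
      refine (Real.rpow_le_rpow_iff (norm_nonneg _) (by positivity)
        (by norm_num : (0 : ℝ) < 2)).1 ?_
      rw [norm_sq_eq]
      exact (summable_lift e T f).2)

/-- The positive square root of a positive operator. -/
def opSqrt {H : Type*} [NormedAddCommGroup H] [InnerProductSpace ℂ H] [CompleteSpace H]
    (T : H →L[ℂ] H) : H →L[ℂ] H :=
  CFC.sqrt T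

/-- Index set of an orthonormal basis of `H_A^{⊗N} ⊗ H_B^{⊗N} ⊗ H_E`, for `H_A = ℓ²(α)`,
`H_B = ℓ²(β)`, `H_E = ℓ²(η)`. -/
abbrev Idx (N : ℕ) (α β η : Type*) := (Fin N → α) × ((Fin N → β) × η)

/-- Split off Alice's `k`-th system. -/
def aliceSplit {N : ℕ} (α β η : Type*) (k : Fin N) :
    Idx N α β η ≃ α × (({j // j ≠ k} → α) × ((Fin N → β) × η)) :=
  ((Equiv.funSplitAt k α).prodCongr (Equiv.refl _)).trans (Equiv.prodAssoc _ _ _)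

/-- Split off Bob's `k`-th system. -/
def bobSplit {N : ℕ} (α β η : Type*) (k : Fin N) :
    Idx N α β η ≃ β × (({j // j ≠ k} → β) × ((Fin N → α) × η)) :=
  ((Equiv.prodAssoc _ _ _).symm.trans
    (((Equiv.prodComm _ _).prodCongr (Equiv.refl _)).trans (Equiv.prodAssoc _ _ _))).trans
    (aliceSplit β α η k)

/-- Split off Eve's system. -/
def eveSplit (N : ℕ) (α β η : Type*) :
    Idx N α β η ≃ η × ((Fin N → α) × (Fin N → β)) :=
  (Equiv.prodAssoc _ _ _).symm.trans (Equiv.prodComm _ _)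

/-- `S₁ ⊗ ⋯ ⊗ S_N ⊗ T₁ ⊗ ⋯ ⊗ T_N ⊗ 1_E`, as the product of the (commuting) operators that act
on one system each. -/
def tensorOp {N : ℕ} {α β : Type*} (η : Type*) (S : Fin N → Op α) (T : Fin N → Op β) :
    Op (Idx N α β η) :=
  (List.ofFn fun k => liftOp (aliceSplit α β η k) (S k)).prod *
    (List.ofFn fun k => liftOp (bobSplit α β η k) (T k)).prod

/-- The partial trace `tr_{A^N B^N} |Φ⟩⟨Φ|`, which is the sum of `|Φ_s⟩⟨Φ_s|` over the basis
vectors `s` of `A^N B^N`, where `Φ_s = ⟨s|Φ⟩ ∈ H_E`. -/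
def reducedEve {N : ℕ} {α β η : Type*} (Φ : L2 (Idx N α β η)) : Op η :=
  ∑' s, InnerProductSpace.rankOne ℂ (slice (eveSplit N α β η) s Φ) (slice (eveSplit N α β η) s Φ)

/-! ### Classical-quantum operators, `L₁`-distance, smooth min-entropy -/

open Classical in
/-- The trace of a positive operator on `ℓ²(η)`, in the standard basis. -/
def trace {η : Type*} (T : Op η) : ℝ≥0∞ :=
  ∑' i, ENNReal.ofReal
    (⟪(lp.single 2 i (1 : ℂ) : L2 η), T (lp.single 2 i (1 : ℂ))⟫_ℂ).re

/-- The trace norm (Schatten 1-norm): the supremum of `∑ |⟨e_j, T f_j⟩|` over all finite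
orthonormal systems `e`, `f`. -/
def traceNorm {η : Type*} (T : Op η) : ℝ≥0∞ :=
  ⨆ (n : ℕ) (e : Fin n → L2 η) (f : Fin n → L2 η) (_ : Orthonormal ℂ e) (_ : Orthonormal ℂ f),
    ∑ j, ‖⟪e j, T (f j)⟫_ℂ‖ₑ

/-- A classical-quantum operator `∑_z |z⟩⟨z| ⊗ ρ_z`, with classical register `Z` and quantum
register `ℓ²(η)`, is given by the family `z ↦ ρ_z`. -/
abbrev CQ (Z η : Type*) := Z → Op η

/-- Trace of a positive classical-quantum operator. -/
def CQ.total {Z η : Type*} (ρ : CQ Z η) : ℝ≥0∞ := ∑' z, trace (ρ z)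

/-- The `L₁`-distance `‖ρ - σ‖₁` of classical-quantum operators. -/
def CQ.dist {Z η : Type*} (ρ σ : CQ Z η) : ℝ≥0∞ := ∑' z, traceNorm (ρ z - σ z)

/-- The classical register is processed by the stochastic map `κ`. -/
def CQ.process {Z W η : Type*} (κ : Z → PMF W) (ρ : CQ Z η) : CQ W η :=
  fun w => ∑' z, ((κ z w).toReal : ℂ) • ρ z

/-- The smooth min-entropy `H_min^ε(ρ_{X C E} | C E)` of an operator that is classical on `X`
and `C`: the supremum of all `t` such that `ρ' ≤ 2^{-t} id_X ⊗ σ_{CE}` for some positive `ρ'`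
with `tr ρ' ≤ tr ρ` and `‖ρ' - ρ‖₁ ≤ ε tr ρ`, and some density operator `σ_{CE}`. -/
def smoothMinEntropy {X C η : Type*} (ε : ℝ≥0) (ρ : CQ (X × C) η) : EReal :=
  ⨆ (ρ' : CQ (X × C) η) (σ : CQ C η) (t : ℝ)
    (_ : ∀ z, 0 ≤ ρ' z) (_ : ρ'.total ≤ ρ.total) (_ : ρ'.dist ρ ≤ ε * ρ.total)
    (_ : ∀ c, 0 ≤ σ c) (_ : σ.total = 1)
    (_ : ∀ x c, ρ' (x, c) ≤ (((2 : ℝ) ^ (-t) : ℝ) : ℂ) • σ c), (t : EReal)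

/-! ### Measurements -/

/-- One party's measurements on a single system `ℓ²(α)`: for each of the `l` blocks a POVM, the
region `Ξ i` of the observed results, the element `D i = ∑_{x ∈ Ξ i} M i x` of that region (the
sum converges strongly), and a POVM element `Dt` that dominates all `D i`. -/
structure Measurement (l : ℕ) (α : Type u) where
  Outcome : Fin l → Type v
  M : ∀ i, Outcome i → Op α
  M_nonneg : ∀ i x, 0 ≤ M i x
  M_sum : ∀ i ψ, HasSum (fun x => M i x ψ) ψ
  Ξ : ∀ i, Set (Outcome i)
  D : Fin l → Op α
  D_sum : ∀ i ψ, HasSum (fun x : Ξ i => M i x ψ) (D i ψ)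
  Dt : Op α
  Dt_nonneg : 0 ≤ Dt
  Dt_le_one : Dt ≤ 1
  D_le_Dt : ∀ i, D i ≤ Dt

/-- The accepted results of a system of block `i`: the region `Ξ i` together with one further
symbol `none`. -/
abbrev Measurement.Acc {l : ℕ} {α : Type*} (m : Measurement l α) (i : Fin l) := Option (m.Ξ i)

/-- The POVM elements of the accepted results; the further symbol stands for `Dt - D i`. -/
def Measurement.effect {l : ℕ} {α : Type*} (m : Measurement l α) (i : Fin l) : m.Acc i → Op α
  | some x => m.M i x
  | none => m.Dt - m.D i

/-- Information reconciliation on the strings `x`, `y`: the joint distribution of the public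
transcript and of Bob's guess of `x` (`none` if the parties abort). -/
structure Reconciliation (XK : Type u) (YK : Type v) where
  Transcript : Type w
  [fin : Fintype Transcript]
  run : XK → YK → PMF (Transcript × Option XK)

/-- The reconciliation is `ε`-secure: whatever the strings are, the probability that Bob ends up
with a wrong guess is at most `ε`. -/
def Reconciliation.IsSecure {XK YK : Type*} (R : Reconciliation XK YK) (ε : ℝ≥0) : Prop :=
  ∀ x y, (R.run x y).toOuterMeasure {o | ∃ x', o.2 = some x' ∧ x' ≠ x} ≤ ε

/-- The leakage `log₂ |C| - inf_{x,y} H_min(C | x, y)` of the transcript `C`. -/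
def Reconciliation.leak {XK YK : Type*} (R : Reconciliation XK YK) : ℝ :=
  letI := R.fin
  Real.logb 2 (Fintype.card R.Transcript) -
    ⨅ p : XK × YK, -Real.logb 2 (⨆ c, (((R.run p.1 p.2).map Prod.fst) c).toReal)

/-! ### The two protocols -/

/-- The data common to the two protocols: `N` systems on each side, the assignment of the systems
to `l` blocks (the first of which is used for parameter estimation), the measurements, the
filters, which are projections onto finite-dimensional subspaces, and the classical
post-processing. -/
structure Scheme (N l : ℕ) [NeZero l] (α : Type*) (β : Type*) (XK : Type*) (YK : Type*)
    (C : Type*) where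
  block : Fin N → Fin l
  alice : Measurement.{_, a} l α
  bob : Measurement.{_, a} l β
  filterA : Submodule ℂ (L2 α)
  filterB : Submodule ℂ (L2 β)
  [finA : FiniteDimensional ℂ filterA]
  [finB : FiniteDimensional ℂ filterB]
  /-- The parameter estimation accepts iff the results of the first block lie in this set. -/
  test : Set (∀ k : {k // block k = 0}, alice.Acc (block k) × bob.Acc (block k))
  /-- The (randomized) data processing, which yields Alice's string, Bob's string and a public
  announcement. -/
  proc : (∀ k, alice.Acc (block k)) × (∀ k, bob.Acc (block k)) → PMF (XK × YK × C)
  recon : Reconciliation.{_, _, a} XK YK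

namespace Scheme

variable {N l : ℕ} [NeZero l] {α β XK YK C : Type*} (Q : Scheme N l α β XK YK C)

/-- The accepted results `(x, y)` of all `N` measurements. -/
abbrev Results := (∀ k, Q.alice.Acc (Q.block k)) × (∀ k, Q.bob.Acc (Q.block k))

/-- The published results of the first block. -/
abbrev Published := ∀ k : {k // Q.block k = 0}, Q.alice.Acc (Q.block k) × Q.bob.Acc (Q.block k)

/-- Restriction of the results to the first block. -/
def publish (s : Q.Results) : Q.Published := fun k => (s.1 k, s.2 k)

/-- The measurement operator `⨂_k √M_{x_k} ⊗ ⨂_k √M_{y_k} ⊗ 1_E` of the results `s = (x, y)`. -/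
def kraus (η : Type*) (s : Q.Results) : Op (Idx N α β η) :=
  tensorOp η (fun k => opSqrt (Q.alice.effect (Q.block k) (s.1 k)))
    (fun k => opSqrt (Q.bob.effect (Q.block k) (s.2 k)))

/-- The normalized state of `X^N Y^N E` after the measurement of all systems of the (not
necessarily normalized) pure state `Φ`, given that all results are accepted.  (It is `0` if the
results are accepted with probability `0`.) -/
def measured {η : Type*} (Φ : L2 (Idx N α β η)) : CQ Q.Results η :=
  fun s => (((∑' s', ‖Q.kraus η s' Φ‖ ^ 2)⁻¹ : ℝ) : ℂ) • reducedEve (Q.kraus η s Φ)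

/-- The filter `(P_A ⊗ P_B)^{⊗N} ⊗ 1_E`. -/
def filter (η : Type*) : Op (Idx N α β η) :=
  letI := Q.finA
  letI := Q.finB
  tensorOp η (fun _ => Q.filterA.starProjection) (fun _ => Q.filterB.starProjection)

/-- The state `ρ_{X^N Y^N E}` of protocol 1. -/
def state1 {η : Type*} (Ψ : L2 (Idx N α β η)) : CQ Q.Results η := Q.measured Ψ

/-- The state of `X^N Y^N E` of protocol 2, in which the systems are filtered before they are
measured. -/
def state2 {η : Type*} (Ψ : L2 (Idx N α β η)) : CQ Q.Results η := Q.measured (Q.filter η Ψ)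

/-- `tr[(Dt_A ⊗ Dt_B)^{⊗N} |Ψ⟩⟨Ψ|]`, the probability of results in the observed range. -/
def rangeProb {η : Type*} (Ψ : L2 (Idx N α β η)) : ℝ :=
  (⟪Ψ, tensorOp η (fun _ => Q.alice.Dt) (fun _ => Q.bob.Dt) Ψ⟫_ℂ).re

open Classical in
/-- The probability that the parameter estimation accepts, for the state `ρ` of `X^N Y^N E`. -/
def testProb {η : Type*} (ρ : CQ Q.Results η) : ℝ≥0∞ :=
  ∑' s, if Q.publish s ∈ Q.test then trace (ρ s) else 0

/-- Alice's string together with everything classical that Eve learns: the published results of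
the first block and the announcement of the data processing. -/
def processed {η : Type*} (ρ : CQ Q.Results η) : CQ (XK × (Q.Published × C)) η :=
  ρ.process fun s => (Q.proc s).map fun o => (o.1, (Q.publish s, o.2.2))

/-- The `ε`-secure key rate.  For each attack `Ψ`, `st Ψ` is the state of `X^N Y^N E` from which
the key is generated, and `est Ψ` is the probability that the data used for parameter estimation
are accepted.  The rate is the supremum over all `ε₁ + ε₂ + ε₃ = ε` for which the
reconciliation is `ε₂`-secure of `(H_min^{ε₁}(X|E) - leak) / N`, where the entropy is the worst
case over all attacks that pass the parameter estimation with probability above `ε₃`. -/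
def keyRate {η : Type*} (attacks : Set (L2 (Idx N α β η)))
    (est : L2 (Idx N α β η) → ℝ≥0∞) (st : L2 (Idx N α β η) → CQ Q.Results η)
    (ε : ℝ≥0) : EReal :=
  ⨆ (ε₁ : ℝ≥0) (ε₂ : ℝ≥0) (ε₃ : ℝ≥0) (_ : ε₁ + ε₂ + ε₃ = ε) (_ : Q.recon.IsSecure ε₂),
    ((⨅ Ψ ∈ attacks, ⨅ (_ : (ε₃ : ℝ≥0∞) < est Ψ),
      smoothMinEntropy ε₁ (Q.processed (st Ψ))) - (Q.recon.leak : EReal)) / (N : EReal)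

/-- The probability that the data of protocol 1 lie in the observed range and pass the parameter
estimation. -/
def est1 {η : Type*} (Ψ : L2 (Idx N α β η)) : ℝ≥0∞ :=
  ENNReal.ofReal (Q.rangeProb Ψ) * Q.testProb (Q.state1 Ψ)

/-- The `ε`-secure key rate of protocol 1. -/
def keyRate1 {η : Type*} (attacks : Set (L2 (Idx N α β η))) (ε : ℝ≥0) : EReal :=
  Q.keyRate attacks Q.est1 Q.state1 ε

/-- The `ε`-secure key rate of protocol 2 when the data of protocol 1 are used in place of those
of protocol 2 for the parameter estimation. -/
def keyRate2 {η : Type*} (attacks : Set (L2 (Idx N α β η))) (ε : ℝ≥0) : EReal :=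
  Q.keyRate attacks Q.est1 Q.state2 ε

/-- The `ε`-secure key rate of protocol 2 when its own data (of the systems that pass the filter,
with results in the observed range) are used for the parameter estimation. -/
def keyRate2Own {η : Type*} (attacks : Set (L2 (Idx N α β η))) (ε : ℝ≥0) : EReal :=
  Q.keyRate attacks (fun Ψ => Q.testProb (Q.state2 Ψ)) Q.state2 ε

end Scheme

end QKD

end

namespace QKD

/-! ### Trace and trace norm -/

section TraceNorm

variable {η : Type*}

/-! A key rate is a supremum over splittings of the error budget into a smoothing part ε₁, a
reconciliation part ε₂ and an acceptance threshold ε₃. To compare two rates, each splitting of the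
smaller budget is enlarged in ε₁ and ε₃ (`keyRate_le_keyRate`), and only the attacks that survive
the higher threshold matter. If such an attack has `est1` above δ, then the results are in range
with probability at least δ (`le_rangeProb_of_lt_est1`), so the hypothesis makes the two states
2δ-close. Closeness is used in two ways. The classical processing is a contraction for the
L₁-distance (`CQ.dist_process_le`), so the min-entropy of one state bounds that of the other once 2δ
is added to the smoothing (`smoothMinEntropy_le_of_dist_le`). Moreover the acceptance probabilities
differ by at most 2δ (`testProb_le_testProb_add_dist`). The first inequality spends 2δ on smoothing
and δ on the threshold. The second compares the same state under two estimates and spends 2δ on the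
threshold alone. -/

theorem traceNorm_neg (T : Op η) : traceNorm (-T) = traceNorm T := by
  simp [traceNorm]

theorem sum_enorm_inner_le_traceNorm (T : Op η) {n : ℕ} {e f : Fin n → L2 η}
    (he : Orthonormal ℂ e) (hf : Orthonormal ℂ f) :
    ∑ j, ‖⟪e j, T (f j)⟫_ℂ‖ₑ ≤ traceNorm T :=
  le_iSup₂_of_le n e (le_iSup₂_of_le f he (le_iSup_of_le hf le_rfl))

theorem traceNorm_le {T : Op η} {b : ℝ≥0∞}
    (h : ∀ (n : ℕ) (e f : Fin n → L2 η), Orthonormal ℂ e → Orthonormal ℂ f →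
      ∑ j, ‖⟪e j, T (f j)⟫_ℂ‖ₑ ≤ b) : traceNorm T ≤ b :=
  iSup₂_le fun n e => iSup₂_le fun f he => iSup_le fun hf => h n e f he hf

theorem traceNorm_add_le (S T : Op η) : traceNorm (S + T) ≤ traceNorm S + traceNorm T := by
  refine traceNorm_le fun n e f he hf => ?_
  calc ∑ j, ‖⟪e j, (S + T) (f j)⟫_ℂ‖ₑ
      ≤ ∑ j, (‖⟪e j, S (f j)⟫_ℂ‖ₑ + ‖⟪e j, T (f j)⟫_ℂ‖ₑ) := by
        refine Finset.sum_le_sum fun j _ => ?_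
        rw [add_apply, inner_add_right]
        exact enorm_add_le _ _
    _ ≤ traceNorm S + traceNorm T := by
        rw [Finset.sum_add_distrib]
        exact add_le_add (sum_enorm_inner_le_traceNorm S he hf)
          (sum_enorm_inner_le_traceNorm T he hf)

/-- A matrix coefficient of a convergent series of operators. -/
theorem hasSum_inner_apply {Z : Type*} {T : Z → Op η} (hT : Summable T) (x y : L2 η) :
    HasSum (fun z => ⟪x, T z y⟫_ℂ) ⟪x, (∑' z, T z) y⟫_ℂ :=
  ((innerSL ℂ x).comp (ContinuousLinearMap.apply ℂ (L2 η) y)).hasSum hT.hasSum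

/-- Matrix coefficients are continuous in the operator norm, so the triangle inequality holds for
each finite pair of orthonormal systems and survives the supremum. -/
theorem traceNorm_tsum_le {Z : Type*} {T : Z → Op η} (hT : Summable T) :
    traceNorm (∑' z, T z) ≤ ∑' z, traceNorm (T z) := by
  refine traceNorm_le fun n e f he hf => ?_
  calc ∑ j, ‖⟪e j, (∑' z, T z) (f j)⟫_ℂ‖ₑ
      ≤ ∑ j, ∑' z, ‖⟪e j, T z (f j)⟫_ℂ‖ₑ := by
        refine Finset.sum_le_sum fun j _ => ?_
        rw [← (hasSum_inner_apply hT (e j) (f j)).tsum_eq]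
        exact enorm_tsum_le_tsum_enorm
    _ = ∑' z, ∑ j, ‖⟪e j, T z (f j)⟫_ℂ‖ₑ :=
        (Summable.tsum_finsetSum fun _ _ => ENNReal.summable).symm
    _ ≤ ∑' z, traceNorm (T z) :=
        ENNReal.tsum_le_tsum fun z => sum_enorm_inner_le_traceNorm (T z) he hf

theorem traceNorm_smul (c : ℂ) (T : Op η) : traceNorm (c • T) ≤ ‖c‖ₑ * traceNorm T := by
  refine traceNorm_le fun n e f he hf => ?_
  simp only [smul_apply, inner_smul_right, enorm_mul, ← Finset.mul_sum]
  gcongr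
  exact sum_enorm_inner_le_traceNorm T he hf

open Classical in
/-- The `i`-th diagonal matrix coefficient in the standard basis. -/
noncomputable def diag (i : η) (T : Op η) : ℝ :=
  (⟪(lp.single 2 i (1 : ℂ) : L2 η), T (lp.single 2 i (1 : ℂ))⟫_ℂ).re

theorem trace_eq_tsum_diag (T : Op η) : trace T = ∑' i, ENNReal.ofReal (diag i T) := rfl

theorem diag_smul (i : η) (c : ℝ) (T : Op η) : diag i ((c : ℂ) • T) = c * diag i T := by
  rw [diag, smul_apply, inner_smul_right, Complex.re_ofReal_mul, diag]

theorem hasSum_diag {Z : Type*} {T : Z → Op η} (hT : Summable T) (i : η) :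
    HasSum (fun z => diag i (T z)) (diag i (∑' z, T z)) :=
  Complex.hasSum_re (hasSum_inner_apply hT _ _)

theorem trace_smul {c : ℝ} (hc : 0 ≤ c) (T : Op η) :
    trace ((c : ℂ) • T) = ENNReal.ofReal c * trace T := by
  simp only [trace_eq_tsum_diag, diag_smul, ENNReal.ofReal_mul hc, ENNReal.tsum_mul_left]

/-- `trace` truncates negative diagonal entries to 0, so additivity needs nonnegative diagonals; the
rest is an exchange of sums in `ℝ≥0∞`. -/
theorem trace_tsum {Z : Type*} {T : Z → Op η} (hT : Summable T) (h0 : ∀ z i, 0 ≤ diag i (T z)) :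
    trace (∑' z, T z) = ∑' z, trace (T z) := by
  simp only [trace_eq_tsum_diag]
  rw [ENNReal.tsum_comm]
  refine tsum_congr fun i => ?_
  rw [← (hasSum_diag hT i).tsum_eq]
  exact ENNReal.ofReal_tsum_of_nonneg (fun z => h0 z i) (hasSum_diag hT i).summable

open Classical in
theorem orthonormal_single : Orthonormal ℂ fun i : η => (lp.single 2 i (1 : ℂ) : L2 η) := by
  rw [orthonormal_iff_ite]
  intro i j
  rw [lp.inner_single_left]
  by_cases h : i = j
  · subst h; simp
  · simp [h]

/-- Finitely many basis vectors, used as both orthonormal systems, are admissible in the supremum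
defining `traceNorm (S - T)`, which therefore bounds every partial sum of diagonal differences. -/
theorem trace_le_trace_add_traceNorm (S T : Op η) :
    trace S ≤ trace T + traceNorm (S - T) := by
  classical
  rw [trace_eq_tsum_diag, trace_eq_tsum_diag, ENNReal.tsum_eq_iSup_sum]
  refine iSup_le fun s => ?_
  have hle : ∀ i, ENNReal.ofReal (diag i S) ≤ ENNReal.ofReal (diag i T) +
      ‖⟪(lp.single 2 i (1 : ℂ) : L2 η), (S - T) (lp.single 2 i (1 : ℂ))⟫_ℂ‖ₑ := by
    intro i
    have : diag i S ≤ diag i T +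
        ‖⟪(lp.single 2 i (1 : ℂ) : L2 η), (S - T) (lp.single 2 i (1 : ℂ))⟫_ℂ‖ := by
      have h := Complex.re_le_norm
        ⟪(lp.single 2 i (1 : ℂ) : L2 η), (S - T) (lp.single 2 i (1 : ℂ))⟫_ℂ
      rw [sub_apply, inner_sub_right] at h ⊢
      rw [Complex.sub_re] at h
      -- The two sides can differ only in the `DecidableEq` instance inside `lp.single`.
      have e1 : ∀ R : Op η, diag i R =
          (⟪(lp.single 2 i (1 : ℂ) : L2 η), R (lp.single 2 i (1 : ℂ))⟫_ℂ).re := by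
        intro R; unfold diag; congr!
      rw [e1 S, e1 T]
      linarith
    calc ENNReal.ofReal (diag i S) ≤ _ := ENNReal.ofReal_le_ofReal this
      _ ≤ _ := ENNReal.ofReal_add_le
      _ = _ := by rw [ofReal_norm]
  calc ∑ i ∈ s, ENNReal.ofReal (diag i S)
      ≤ ∑ i ∈ s, ENNReal.ofReal (diag i T) +
        ∑ i ∈ s, ‖⟪(lp.single 2 i (1 : ℂ) : L2 η), (S - T) (lp.single 2 i (1 : ℂ))⟫_ℂ‖ₑ := by
        rw [← Finset.sum_add_distrib]
        exact Finset.sum_le_sum fun i _ => hle i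
    _ ≤ _ := by
        refine add_le_add (ENNReal.sum_le_tsum s) ?_
        have hon : Orthonormal ℂ fun j : Fin s.card =>
            (lp.single 2 (s.equivFin.symm j : η) (1 : ℂ) : L2 η) := by
          convert! orthonormal_single.comp (fun j : Fin s.card => (s.equivFin.symm j : η))
            (Subtype.val_injective.comp s.equivFin.symm.injective)
        refine le_trans (le_of_eq ?_) (sum_enorm_inner_le_traceNorm (S - T) hon hon)
        rw [← Finset.sum_coe_sort s, ← s.equivFin.symm.sum_comp]

end TraceNorm

/-! ### The partial trace -/

section ReducedEve

variable {N : ℕ} {α β η : Type*}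

theorem hasSum_norm_sq_slice {ι α ρ : Type*} (e : ι ≃ α × ρ) (f : L2 ι) :
    HasSum (fun r => ‖slice e r f‖ ^ 2) (‖f‖ ^ 2) := by
  simpa using hasSum_slice e f

theorem hasSum_norm_sq_apply {ι : Type*} (f : L2 ι) :
    HasSum (fun i => ‖f i‖ ^ 2) (‖f‖ ^ 2) := by
  have := (summable_sq f).hasSum
  rw [← norm_sq_eq] at this
  simpa using this

theorem norm_rankOne_self (v : L2 η) : ‖InnerProductSpace.rankOne ℂ v v‖ = ‖v‖ ^ 2 := by
  rw [InnerProductSpace.norm_rankOne, sq]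

theorem diag_rankOne_self (i : η) (v : L2 η) :
    diag i (InnerProductSpace.rankOne ℂ v v) = ‖v i‖ ^ 2 := by
  classical
  unfold diag
  rw [InnerProductSpace.rankOne_apply, inner_smul_right, lp.inner_single_left,
    lp.inner_single_right]
  simp only [RCLike.inner_apply, map_one, mul_one, one_mul]
  rw [RCLike.conj_mul]
  norm_cast

/-- The norms are the squared norms of the slices, which sum to `‖Φ‖ ^ 2`; hence the series defining
`reducedEve` converges absolutely and its `tsum` is not a default value. -/
theorem summable_norm_rankOne_slice (Φ : L2 (Idx N α β η)) :
    Summable fun s => ‖InnerProductSpace.rankOne ℂ (slice (eveSplit N α β η) s Φ)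
      (slice (eveSplit N α β η) s Φ)‖ := by
  simp only [norm_rankOne_self]
  exact (hasSum_norm_sq_slice _ Φ).summable

theorem norm_reducedEve_le (Φ : L2 (Idx N α β η)) : ‖reducedEve Φ‖ ≤ ‖Φ‖ ^ 2 := by
  refine (norm_tsum_le_tsum_norm (summable_norm_rankOne_slice Φ)).trans ?_
  simp only [norm_rankOne_self]
  exact (hasSum_norm_sq_slice _ Φ).tsum_eq.le

theorem diag_reducedEve_nonneg (Φ : L2 (Idx N α β η)) (i : η) : 0 ≤ diag i (reducedEve Φ) :=
  (hasSum_diag (summable_norm_rankOne_slice Φ).of_norm i).nonneg fun s => by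
    rw [diag_rankOne_self]; positivity

theorem trace_rankOne_self (v : L2 η) :
    trace (InnerProductSpace.rankOne ℂ v v) = ENNReal.ofReal (‖v‖ ^ 2) := by
  have h := hasSum_norm_sq_apply v
  simp only [trace_eq_tsum_diag, diag_rankOne_self]
  rw [← h.tsum_eq, ENNReal.ofReal_tsum_of_nonneg (fun _ => by positivity) h.summable]

theorem trace_reducedEve (Φ : L2 (Idx N α β η)) :
    trace (reducedEve Φ) = ENNReal.ofReal (‖Φ‖ ^ 2) := by
  have h := hasSum_norm_sq_slice (eveSplit N α β η) Φ
  rw [reducedEve, trace_tsum (summable_norm_rankOne_slice Φ).of_norm fun s i => by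
    rw [diag_rankOne_self]; positivity]
  simp only [trace_rankOne_self]
  rw [← h.tsum_eq, ENNReal.ofReal_tsum_of_nonneg (fun _ => by positivity) h.summable]

end ReducedEve

/-! ### Classical-quantum operators -/

namespace CQ

variable {Z W η : Type*}

theorem dist_comm (ρ σ : CQ Z η) : ρ.dist σ = σ.dist ρ := by
  refine tsum_congr fun z => ?_
  rw [← traceNorm_neg, neg_sub]

theorem dist_triangle (ρ σ τ : CQ Z η) : ρ.dist τ ≤ ρ.dist σ + σ.dist τ := by
  unfold dist
  rw [← ENNReal.tsum_add]
  refine ENNReal.tsum_le_tsum fun z => ?_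
  rw [← sub_add_sub_cancel (ρ z) (σ z) (τ z)]
  exact traceNorm_add_le _ _

/-- The weights are at most 1, so the series in `CQ.process` are dominated by `‖ρ z‖`. -/
theorem summable_process {ρ : CQ Z η} (hρ : Summable fun z => ‖ρ z‖) (κ : Z → PMF W) (w : W) :
    Summable fun z => ((κ z w).toReal : ℂ) • ρ z := by
  refine Summable.of_norm_bounded hρ fun z => ?_
  rw [norm_smul, Complex.norm_real, Real.norm_of_nonneg ENNReal.toReal_nonneg]
  refine mul_le_of_le_one_left (norm_nonneg _) ?_
  exact ENNReal.toReal_le_of_le_ofReal zero_le_one (by simpa using (κ z).coe_le_one w)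

/-- Tonelli and the total mass 1 of each `κ z`; both the trace and the distance statement for
stochastic maps reduce to this. -/
theorem tsum_pmf_mul (κ : Z → PMF W) (g : Z → ℝ≥0∞) :
    ∑' w, ∑' z, κ z w * g z = ∑' z, g z := by
  rw [ENNReal.tsum_comm]
  refine tsum_congr fun z => ?_
  rw [ENNReal.tsum_mul_right, (κ z).tsum_coe, one_mul]

/-- A stochastic map preserves the trace. -/
theorem total_process {ρ : CQ Z η} (hρ : Summable fun z => ‖ρ z‖)
    (h0 : ∀ z i, 0 ≤ diag i (ρ z)) (κ : Z → PMF W) : (ρ.process κ).total = ρ.total := by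
  unfold total process
  rw [← tsum_pmf_mul κ]
  refine tsum_congr fun w => ?_
  rw [trace_tsum (summable_process hρ κ w) fun z i => by
    rw [diag_smul]; exact mul_nonneg ENNReal.toReal_nonneg (h0 z i)]
  refine tsum_congr fun z => ?_
  rw [trace_smul ENNReal.toReal_nonneg, ENNReal.ofReal_toReal ((κ z).apply_ne_top w)]

/-- A stochastic map does not increase the `L₁`-distance. -/
theorem dist_process_le {ρ σ : CQ Z η} (hρ : Summable fun z => ‖ρ z‖)
    (hσ : Summable fun z => ‖σ z‖) (κ : Z → PMF W) :
    (ρ.process κ).dist (σ.process κ) ≤ ρ.dist σ := by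
  unfold dist process
  rw [← tsum_pmf_mul κ fun z => traceNorm (ρ z - σ z)]
  refine ENNReal.tsum_le_tsum fun w => ?_
  have h1 := summable_process hρ κ w
  have h2 := summable_process hσ κ w
  rw [← h1.tsum_sub h2]
  refine (traceNorm_tsum_le (h1.sub h2)).trans (ENNReal.tsum_le_tsum fun z => ?_)
  rw [← smul_sub]
  refine (traceNorm_smul _ _).trans_eq ?_
  rw [← ofReal_norm, Complex.norm_real, Real.norm_of_nonneg ENNReal.toReal_nonneg,
    ENNReal.ofReal_toReal ((κ z).apply_ne_top w)]

end CQ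

/-- Changing the state by `δ` in `L₁`-distance costs `δ` in the smoothing parameter. -/
theorem smoothMinEntropy_le_of_dist_le {X C η : Type*} {ε δ : ℝ≥0} {ρ σ : CQ (X × C) η}
    (htot : σ.total ≤ ρ.total) (hdist : σ.dist ρ ≤ δ * ρ.total) :
    smoothMinEntropy ε σ ≤ smoothMinEntropy (ε + δ) ρ := by
  refine iSup₂_le fun ρ' τ => iSup₂_le fun t h0 => iSup₂_le fun h1 h2 => iSup₂_le fun h3 h4 =>
    iSup_le fun h5 => ?_
  -- The witnesses for `σ` serve unchanged for `ρ`. Since trace bound and smoothing radius are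
  -- relative to the trace, `htot` is needed for both.
  refine le_iSup₂_of_le ρ' τ (le_iSup₂_of_le t h0 (le_iSup₂_of_le (h1.trans htot) ?_
    (le_iSup₂_of_le h3 h4 (le_iSup_of_le h5 le_rfl))))
  calc ρ'.dist ρ ≤ ρ'.dist σ + σ.dist ρ := CQ.dist_triangle _ _ _
    _ ≤ ε * ρ.total + δ * ρ.total := by
        refine add_le_add (h2.trans ?_) hdist
        gcongr
    _ = _ := by rw [← add_mul, ENNReal.coe_add]

/-! ### Tensor products of contractions -/

theorem norm_liftOp_le {ι α ρ : Type*} (e : ι ≃ α × ρ) (T : Op α) : ‖liftOp e T‖ ≤ ‖T‖ :=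
  LinearMap.mkContinuous_norm_le _ (norm_nonneg _) _

theorem norm_list_prod_le_one {ι : Type*} (L : List (Op ι)) (hL : ∀ T ∈ L, ‖T‖ ≤ 1) :
    ‖L.prod‖ ≤ 1 := by
  induction L with
  | nil => exact ContinuousLinearMap.norm_id_le
  | cons T L ih =>
    rw [List.prod_cons]
    exact (norm_mul_le _ _).trans (mul_le_one₀ (hL T (by simp)) (norm_nonneg _)
      (ih fun S hS => hL S (by simp [hS])))

theorem norm_tensorOp_le_one {N : ℕ} {α β : Type*} (η : Type*) {S : Fin N → Op α}
    {T : Fin N → Op β} (hS : ∀ k, ‖S k‖ ≤ 1) (hT : ∀ k, ‖T k‖ ≤ 1) :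
    ‖tensorOp η S T‖ ≤ 1 := by
  refine (norm_mul_le _ _).trans (mul_le_one₀ ?_ (norm_nonneg _) ?_) <;>
    refine norm_list_prod_le_one _ fun R hR => ?_ <;>
    obtain ⟨k, rfl⟩ := (List.mem_ofFn' _ _).1 hR
  · exact (norm_liftOp_le _ _).trans (hS k)
  · exact (norm_liftOp_le _ _).trans (hT k)

theorem Measurement.norm_Dt_le_one {l : ℕ} {α : Type*} (m : Measurement l α) : ‖m.Dt‖ ≤ 1 :=
  (CStarAlgebra.norm_le_norm_of_nonneg_of_le m.Dt_nonneg m.Dt_le_one).trans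
    ContinuousLinearMap.norm_id_le

/-! ### The two protocols -/

namespace Scheme

variable {N l : ℕ} [NeZero l] {α β η XK YK C : Type*} (Q : Scheme N l α β XK YK C)

theorem rangeProb_le_one {Ψ : L2 (Idx N α β η)} (hΨ : ‖Ψ‖ = 1) : Q.rangeProb Ψ ≤ 1 := by
  refine (Complex.re_le_norm _).trans ((norm_inner_le_norm _ _).trans ?_)
  rw [hΨ, one_mul]
  refine (ContinuousLinearMap.le_opNorm _ _).trans ?_
  rw [hΨ, mul_one]
  exact norm_tensorOp_le_one η (fun _ => Q.alice.norm_Dt_le_one) fun _ => Q.bob.norm_Dt_le_one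

theorem normalization_nonneg (Φ : L2 (Idx N α β η)) :
    0 ≤ (∑' s, ‖Q.kraus η s Φ‖ ^ 2)⁻¹ :=
  inv_nonneg.2 (tsum_nonneg fun _ => by positivity)

theorem diag_measured_nonneg (Φ : L2 (Idx N α β η)) (s : Q.Results) (i : η) :
    0 ≤ diag i (Q.measured Φ s) := by
  rw [measured, diag_smul]
  exact mul_nonneg (Q.normalization_nonneg Φ) (diag_reducedEve_nonneg _ i)

theorem summable_norm_measured (Φ : L2 (Idx N α β η)) :
    Summable fun s => ‖Q.measured Φ s‖ := by
  by_cases h : Summable fun s => ‖Q.kraus η s Φ‖ ^ 2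
  · refine Summable.of_nonneg_of_le (fun _ => norm_nonneg _) (fun s => ?_)
      (h.mul_left (∑' s, ‖Q.kraus η s Φ‖ ^ 2)⁻¹)
    rw [measured, norm_smul, Complex.norm_real, Real.norm_of_nonneg (Q.normalization_nonneg Φ)]
    exact mul_le_mul_of_nonneg_left (norm_reducedEve_le _) (Q.normalization_nonneg Φ)
  -- A divergent normalization is read as 0, with inverse 0, so the state vanishes.
  · simp [measured, tsum_eq_zero_of_not_summable h, summable_zero]

theorem trace_measured (Φ : L2 (Idx N α β η)) (s : Q.Results) :
    trace (Q.measured Φ s) =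
      ENNReal.ofReal ((∑' s, ‖Q.kraus η s Φ‖ ^ 2)⁻¹ * ‖Q.kraus η s Φ‖ ^ 2) := by
  rw [measured, trace_smul (Q.normalization_nonneg Φ), trace_reducedEve,
    ENNReal.ofReal_mul (Q.normalization_nonneg Φ)]

/-- The state is divided by its own total weight; the value 0 occurs when that weight is 0, as a
genuine sum or by the default for divergence. -/
theorem total_measured (Φ : L2 (Idx N α β η)) :
    (Q.measured Φ).total = 0 ∨ (Q.measured Φ).total = 1 := by
  simp only [CQ.total, trace_measured]
  by_cases h0 : ∑' s, ‖Q.kraus η s Φ‖ ^ 2 = 0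
  · left; simp [h0]
  · right
    have h : Summable fun s => ‖Q.kraus η s Φ‖ ^ 2 := by
      by_contra h; exact h0 (tsum_eq_zero_of_not_summable h)
    rw [← ENNReal.ofReal_tsum_of_nonneg
      (fun s => mul_nonneg (Q.normalization_nonneg Φ) (by positivity)) (h.mul_left _),
      tsum_mul_left, inv_mul_cancel₀ h0, ENNReal.ofReal_one]

theorem total_measured_le_one (Φ : L2 (Idx N α β η)) : (Q.measured Φ).total ≤ 1 := by
  rcases Q.total_measured Φ with h | h <;> simp [h]

theorem total_processed_measured (Φ : L2 (Idx N α β η)) :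
    (Q.processed (Q.measured Φ)).total = (Q.measured Φ).total :=
  CQ.total_process (Q.summable_norm_measured Φ) (Q.diag_measured_nonneg Φ) _

theorem dist_processed_measured_le (Φ Φ' : L2 (Idx N α β η)) :
    (Q.processed (Q.measured Φ)).dist (Q.processed (Q.measured Φ')) ≤
      (Q.measured Φ).dist (Q.measured Φ') :=
  CQ.dist_process_le (Q.summable_norm_measured Φ) (Q.summable_norm_measured Φ') _

theorem testProb_le_total (ρ : CQ Q.Results η) : Q.testProb ρ ≤ ρ.total :=
  ENNReal.tsum_le_tsum fun s => by split_ifs <;> simp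

theorem testProb_le_testProb_add_dist (ρ σ : CQ Q.Results η) :
    Q.testProb ρ ≤ Q.testProb σ + ρ.dist σ := by
  unfold testProb CQ.dist
  rw [← ENNReal.tsum_add]
  refine ENNReal.tsum_le_tsum fun s => ?_
  split_ifs
  · exact trace_le_trace_add_traceNorm _ _
  · simp

theorem est1_le_rangeProb (Ψ : L2 (Idx N α β η)) :
    Q.est1 Ψ ≤ ENNReal.ofReal (Q.rangeProb Ψ) :=
  mul_le_of_le_one_right' ((Q.testProb_le_total _).trans (Q.total_measured_le_one Ψ))

theorem est1_le_testProb {Ψ : L2 (Idx N α β η)} (hΨ : ‖Ψ‖ = 1) :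
    Q.est1 Ψ ≤ Q.testProb (Q.state1 Ψ) :=
  mul_le_of_le_one_left' (ENNReal.ofReal_le_one.2 (Q.rangeProb_le_one hΨ))

/-- This brings an attack within reach of the closeness hypothesis: `est1` is `rangeProb` times a
probability. -/
theorem le_rangeProb_of_lt_est1 {Ψ : L2 (Idx N α β η)} {δ : ℝ≥0} (h : δ < Q.est1 Ψ) :
    (δ : ℝ) ≤ Q.rangeProb Ψ := by
  have h' := h.trans_le (Q.est1_le_rangeProb Ψ)
  rw [← ENNReal.ofReal_coe_nnreal] at h'
  exact (ENNReal.ofReal_lt_ofReal_iff'.1 h').1.le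

theorem total_state1_of_est1_ne_zero {Ψ : L2 (Idx N α β η)} (h : Q.est1 Ψ ≠ 0) :
    (Q.state1 Ψ).total = 1 := by
  refine (Q.total_measured Ψ).resolve_left fun h0 => h ?_
  have : Q.testProb (Q.state1 Ψ) = 0 :=
    le_antisymm ((Q.testProb_le_total _).trans h0.le) bot_le
  rw [est1, this, mul_zero]

/-- Comparison of two key rates whose error budgets are related by `ε₁ ↦ ε₁ + a`,
`ε₃ ↦ ε₃ + b`. -/
theorem keyRate_le_keyRate {attacks : Set (L2 (Idx N α β η))}
    {est est' : L2 (Idx N α β η) → ℝ≥0∞} {st st' : L2 (Idx N α β η) → CQ Q.Results η}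
    {ε ε' a b : ℝ≥0} (hε : ε + (a + b) = ε')
    (hest : ∀ Ψ ∈ attacks, ∀ ε₃ : ℝ≥0, ((ε₃ + b : ℝ≥0) : ℝ≥0∞) < est' Ψ → ε₃ < est Ψ)
    (hst : ∀ Ψ ∈ attacks, (b : ℝ≥0∞) < est' Ψ → ∀ ε₁ : ℝ≥0,
      smoothMinEntropy ε₁ (Q.processed (st Ψ)) ≤
        smoothMinEntropy (ε₁ + a) (Q.processed (st' Ψ))) :
    Q.keyRate attacks est st ε ≤ Q.keyRate attacks est' st' ε' := by
  refine iSup₂_le fun ε₁ ε₂ => iSup₂_le fun ε₃ h => iSup_le fun hsec => ?_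
  -- ε₂ stays fixed, so the security of the reconciliation carries over.
  refine le_iSup₂_of_le (ε₁ + a) ε₂ (le_iSup₂_of_le (ε₃ + b) ?_ (le_iSup_of_le hsec ?_))
  · rw [← hε, ← h]; ring
  refine EReal.div_le_div_right_of_nonneg (by exact_mod_cast N.zero_le) (EReal.sub_le_sub ?_ le_rfl)
  refine le_iInf₂ fun Ψ hΨ => le_iInf fun hlt => ?_
  refine (iInf₂_le Ψ hΨ).trans ((iInf_le _ (hest Ψ hΨ ε₃ hlt)).trans ?_)
  exact hst Ψ hΨ (lt_of_le_of_lt (by exact_mod_cast le_add_self) hlt) ε₁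

end Scheme

end QKD

theorem theorem2 {N l : ℕ} [NeZero l] (hN : 0 < N) {α β η XK YK C : Type*}
    (Q : QKD.Scheme N l α β XK YK C)
    (attacks : Set (QKD.L2 (QKD.Idx N α β η))) (hattacks : ∀ Ψ ∈ attacks, ‖Ψ‖ = 1)
    (δ ε : NNReal) (hδ : 0 < δ)
    (hclose : ∀ Ψ ∈ attacks, (δ : ℝ) ≤ Q.rangeProb Ψ →
      (Q.state1 Ψ).dist (Q.state2 Ψ) ≤ 2 * δ) :
    Q.keyRate2 attacks (2 * δ + ε) ≤ Q.keyRate1 attacks (5 * δ + ε) ∧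
      Q.keyRate2Own attacks ε ≤ Q.keyRate2 attacks (2 * δ + ε) := by
  constructor
  -- The extra 3δ: 2δ for the distance of the states, δ to force `rangeProb` to be at least δ.
  · refine Q.keyRate_le_keyRate (a := 2 * δ) (b := δ) (by ring) ?_ ?_
    · intro Ψ _ ε₃ h
      exact lt_of_le_of_lt (by exact_mod_cast le_self_add) h
    · intro Ψ hΨ hlt ε₁
      -- Trace 1 makes the relative smoothing radius absolute; the filtered state may still have
      -- trace 0.
      have htot : (Q.processed (Q.state1 Ψ)).total = 1 :=
        (Q.total_processed_measured Ψ).trans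
          (Q.total_state1_of_est1_ne_zero (ne_bot_of_gt hlt))
      refine QKD.smoothMinEntropy_le_of_dist_le ?_ ?_
      · rw [htot]
        exact (Q.total_processed_measured _).trans_le (Q.total_measured_le_one _)
      · rw [htot, mul_one, QKD.CQ.dist_comm]
        refine (Q.dist_processed_measured_le _ _).trans ?_
        exact_mod_cast hclose Ψ hΨ (Q.le_rangeProb_of_lt_est1 hlt)
  -- The key state is the same on both sides, so nothing is spent on smoothing.
  · refine Q.keyRate_le_keyRate (a := 0) (b := 2 * δ) (by ring) ?_ ?_
    · intro Ψ hΨ ε₃ h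
      have hd : (Q.state1 Ψ).dist (Q.state2 Ψ) ≤ 2 * δ :=
        -- The threshold ε₃ + 2δ also exceeds δ, as closeness requires.
        hclose Ψ hΨ (Q.le_rangeProb_of_lt_est1 (lt_of_le_of_lt (by
          norm_cast; exact (le_mul_of_one_le_left' one_le_two).trans le_add_self) h))
      -- ε₃ + 2δ < `est1` ≤ test probability of `state1` ≤ that of `state2` + 2δ; then 2δ cancels.
      have h1 := h.trans_le ((Q.est1_le_testProb (hattacks Ψ hΨ)).trans
        ((Q.testProb_le_testProb_add_dist _ (Q.state2 Ψ)).trans (add_le_add_right hd _)))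
      push_cast at h1
      exact lt_of_add_lt_add_right h1
    · intro Ψ _ _ ε₁
      rw [add_zero]
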